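/- Let $Z(t)=m+Y(t)$, $t\ge 0$, where $m\in\mathbb C$ and $Y=Y_1+iY_2$ is the stationary complex Ornstein--Uhlenbeck process with damping parameter $\lambda>0$ and frequency $\omega$, normalized to unit variances; that is, $(Y_1,Y_2)^\top$ is the centered Gaussian process with $$\mathsf E\begin{bmatrix}Y_1(t+\tau)\\Y_2(t+\tau)\end{bmatrix}\begin{bmatrix}Y_1(t)\\Y_2(t)\end{bmatrix}^{\top}=e^{-\lambda\tau}\begin{bmatrix}\cos(\omega\tau)&-\sin(\omega\tau)\\ \sin(\omega\tau)&\cos(\omega\tau)\end{bmatrix},\qquad t,\tau\ge 0.$$ Let $n\ge 2$. An admissible design is a choice of $n$ points $0\le t_1<t_2<\dots<t_n$; put $d_j:=t_{j+1}-t_j$, $1\le j\le n-1$. Let $C$ be the $2n\times 2n$ covariance matrix of the observations $\big(\mathrm{Re}\,Z(t_j),\mathrm{Im}\,Z(t_j)\big)$, $j=1,\dots,n$, and, for $\alpha,\beta\in\{\lambda,\omega\}$, $$\mathcal I_{\alpha,\beta}:=\tfrac12\,\mathrm{tr}\Big\{C^{-1}\frac{\partial C}{\partial\alpha}C^{-1}\frac{\partial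 C}{\partial\beta}\Big\},\qquad \mathcal I_\lambda:=\mathcal I_{\lambda,\lambda},\quad \mathcal I_\omega:=\mathcal I_{\omega,\omega},$$ the entries of the Fisher information matrix $\begin{bmatrix}\mathcal I_\lambda&\mathcal I_{\lambda,\omega}\\ \mathcal I_{\lambda,\omega}&\mathcal I_\omega\end{bmatrix}$ on $(\lambda,\omega)$. Assume $\omega\neq 0$. Among all admissible $n$-point designs: (a) no design maximizes $\mathcal I_\lambda$; that is, there is no admissible D-optimal design for the damping parameter $\lambda$; (b) a design maximizes $\mathcal I_\omega$ if and only if it is equidistant with $$d_1=\dots=d_{n-1}=\frac1\lambda\Big(\frac{W(-2e^{-2})}2+1\Big)\approx\frac{0.7968}{\lambda},$$ where $W$ is the principal branch of the Lambert $W$-function, i.e. $W(x)$ is the solution $w\ge -1$ of $we^w=x$ for $x\ge -1/e$; (c) the equation $1-d-2de^{-2d}-e^{-4d}=0$ has exactly one positive solution $d^\circ\approx 0.4930$, and a design maximizes the determinant of the Fisher information matrix on $(\lambda,\omega)$ if and only if it is equidistant with $d_1=\dots=d_{n-1}=d^\circ/\lambda$. Both decimal approximations (of $W(-2e^{-2})/2+1$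 and of $d^\circ$) are correct to within $5\cdot 10^{-5}$. -/

import Mathlib

open MeasureTheory ProbabilityTheory
open scoped NNReal

namespace ComplexOU

/-- The two real coordinates of a complex number: index `0` is the real part, index `1` the
imaginary part. -/
noncomputable def coord (a : Fin 2) (z : ℂ) : ℝ := ![z.re, z.im] a

/-- The matrix covariance function `R(τ) = σ² / (2 lam) * exp (τ A)`, with
`A = !![-lam, -om; om, -lam]`, of the two-dimensional stationary Ornstein-Uhlenbeck process with
damping `lam`, frequency `om` and diffusion coefficient `σ`. The matrix exponential is written as
`exp (-lam τ)` times the rotation by the angle `om τ`. -/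
noncomputable def covFun (lam om σ τ : ℝ) : Matrix (Fin 2) (Fin 2) ℝ :=
  (σ ^ 2 / (2 * lam) * Real.exp (-lam * τ)) •
    !![Real.cos (om * τ), -Real.sin (om * τ); Real.sin (om * τ), Real.cos (om * τ)]

/-- `Y` has, under `μ`, the law of the stationary complex Ornstein-Uhlenbeck process
`dY = -(lam - i om) Y dt + σ dW`: it is a centered Gaussian process in `ℂ = ℝ²` with
`E [Y (t + τ) (Y t)ᵀ] = R(τ)` for `τ ≥ 0`. -/
structure IsStationaryOU {Ω : Type*} [MeasurableSpace Ω] (Y : ℝ≥0 → Ω → ℂ) (μ : Measure Ω)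
    (lam om σ : ℝ) : Prop where
  gaussian : IsGaussianProcess Y μ
  centered : ∀ t, ∫ w, Y t w ∂μ = 0
  covariance : ∀ (t τ : ℝ≥0) (a b : Fin 2),
    covariance (fun w => coord a (Y (t + τ) w)) (fun w => coord b (Y t w)) μ =
      covFun lam om σ τ a b

/-- The statistical model `Z t = m + Y t` with constant trend `m`: under `P m lam om` the process
`Z - m` is a stationary complex Ornstein-Uhlenbeck process with damping `lam > 0` and frequency
`om`, normalized so that both coordinates have variance `σ² / (2 lam) = 1`. -/
def IsConstantTrendModel {Ω : Type*} [MeasurableSpace Ω] (Z : ℝ≥0 → Ω → ℂ)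
    (P : ℂ → ℝ → ℝ → Measure Ω) : Prop :=
  ∀ (m : ℂ) (lam om : ℝ), 0 < lam →
    IsStationaryOU (fun t w => Z t w - m) (P m lam om) lam om (Real.sqrt (2 * lam))

/-- The `2n × 2n` covariance matrix `C(n)` of the observations
`Re Z (t 0), Im Z (t 0), …, Re Z (t (n - 1)), Im Z (t (n - 1))`. -/
noncomputable def obsCov {Ω : Type*} [MeasurableSpace Ω] (Z : ℝ≥0 → Ω → ℂ) (μ : Measure Ω)
    {n : ℕ} (t : Fin n → ℝ≥0) : Matrix (Fin n × Fin 2) (Fin n × Fin 2) ℝ :=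
  Matrix.of fun p q =>
    covariance (fun w => coord p.2 (Z (t p.1) w)) (fun w => coord q.2 (Z (t q.1) w)) μ

section Information

variable {Ω : Type*} [MeasurableSpace Ω] (Z : ℝ≥0 → Ω → ℂ) (P : ℂ → ℝ → ℝ → Measure Ω)
  (m : ℂ) (lam om : ℝ) {n : ℕ} (t : Fin n → ℝ≥0)

/-- The entrywise partial derivative of the covariance matrix with respect to the damping. -/
noncomputable def dDamping : Matrix (Fin n × Fin 2) (Fin n × Fin 2) ℝ :=
  Matrix.of fun p q => deriv (fun l => obsCov Z (P m l om) t p q) lam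

/-- The entrywise partial derivative of the covariance matrix with respect to the frequency. -/
noncomputable def dFrequency : Matrix (Fin n × Fin 2) (Fin n × Fin 2) ℝ :=
  Matrix.of fun p q => deriv (fun o => obsCov Z (P m lam o) t p q) om

/-- The Fisher information `½ tr (C⁻¹ ∂C/∂lam C⁻¹ ∂C/∂lam)` on the damping. -/
noncomputable def infoDamping : ℝ :=
  1 / 2 * ((obsCov Z (P m lam om) t)⁻¹ * dDamping Z P m lam om t *
    (obsCov Z (P m lam om) t)⁻¹ * dDamping Z P m lam om t).trace

/-- The Fisher information `½ tr (C⁻¹ ∂C/∂om C⁻¹ ∂C/∂om)` on the frequency. -/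
noncomputable def infoFrequency : ℝ :=
  1 / 2 * ((obsCov Z (P m lam om) t)⁻¹ * dFrequency Z P m lam om t *
    (obsCov Z (P m lam om) t)⁻¹ * dFrequency Z P m lam om t).trace

/-- The mixed entry `½ tr (C⁻¹ ∂C/∂lam C⁻¹ ∂C/∂om)` of the information matrix. -/
noncomputable def infoMixed : ℝ :=
  1 / 2 * ((obsCov Z (P m lam om) t)⁻¹ * dDamping Z P m lam om t *
    (obsCov Z (P m lam om) t)⁻¹ * dFrequency Z P m lam om t).trace

/-- The Fisher information matrix on (damping, frequency). -/
noncomputable def infoMatrix : Matrix (Fin 2) (Fin 2) ℝ :=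
  !![infoDamping Z P m lam om t, infoMixed Z P m lam om t;
    infoMixed Z P m lam om t, infoFrequency Z P m lam om t]

end Information

/-- An admissible `n`-point design: `0 ≤ t 0 < t 1 < … < t (n - 1)`. -/
def IsAdmissible {n : ℕ} (t : Fin n → ℝ≥0) : Prop := StrictMono t

/-- `t` is an admissible `n`-point design that maximizes the criterion `crit` among all admissible
`n`-point designs. -/
def IsOptimalDesign {n : ℕ} (crit : (Fin n → ℝ≥0) → ℝ) (t : Fin n → ℝ≥0) : Prop :=
  IsAdmissible t ∧ ∀ s : Fin n → ℝ≥0, IsAdmissible s → crit s ≤ crit t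

/-- All consecutive points of `t` are at distance `d`. -/
def IsEquidistant {n : ℕ} (t : Fin n → ℝ≥0) (d : ℝ) : Prop :=
  ∀ (j : ℕ) (hj : j + 1 < n),
    (t ⟨j + 1, hj⟩ : ℝ) - (t ⟨j, Nat.lt_of_succ_lt hj⟩ : ℝ) = d

/-- The principal branch of the real Lambert function on `[-1/e, ∞)`: the inverse of the map
`w ↦ w * exp w` restricted to `[-1, ∞)`. -/
noncomputable def lambertW : ℝ → ℝ :=
  Function.invFunOn (fun w : ℝ => w * Real.exp w) (Set.Ici (-1))

end ComplexOU

/-!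
Identifying `ℝ²` with `ℂ` turns the covariance matrix of the observations into the realification of
the complex matrix `H = (exp (-lam |tᵢ - tⱼ| + i om (tᵢ - tⱼ)))`. The process is Markov, so `H⁻¹` is
explicit: it is the sum of the squares of the one-step prediction errors, each divided by its
variance. Since `∂(H⁻¹) = -H⁻¹ ∂H H⁻¹`, the traces defining the Fisher information are derivatives
of `tr (H⁻¹ B)` with `B` constant, and they split into contributions of the single gaps. With
`xⱼ = lam (tⱼ₊₁ - tⱼ)` the informations on damping and frequency are `2 / lam²` times the sums of
`A (xⱼ) = xⱼ² (exp (2 xⱼ) + 1) / (exp (2 xⱼ) - 1)²` and `B (xⱼ) = xⱼ² / (exp (2 xⱼ) - 1)`, and the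
mixed information vanishes.

(a) `A (x / 2) > A x`, so halving all times improves every design. (b) `B` increases up to its
unique critical point and decreases afterwards. (c) By AM-GM it is enough to maximize the linearized
criterion `A x * B d + A d * B x`, which is proportional to
`x² (exp (2 d) exp (2 x) - 1) / (exp (2 x) - 1)²`; its derivative has the sign of
`1 - L x * (exp (2 d) exp (2 x) - 1)`, where the Langevin function `L x = coth x - 1 / x` is
positive and increasing.
-/

namespace ComplexOU

open Matrix
open scoped Topology

/-! ### Correlation matrices of Markov vectors -/

section MatrixCalculus

variable {𝕜 K n : Type*} [NontriviallyNormedField 𝕜] [NormedCommRing K] [NormedAlgebra 𝕜 K]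
  [Fintype n]

lemma hasDerivAt_matrix_mul {A B : 𝕜 → Matrix n n K} {A' B' : Matrix n n K} {x : 𝕜}
    (hA : ∀ i j, HasDerivAt (fun s => A s i j) (A' i j) x)
    (hB : ∀ i j, HasDerivAt (fun s => B s i j) (B' i j) x) (i j : n) :
    HasDerivAt (fun s => (A s * B s) i j) ((A' * B x + A x * B') i j) x := by
  simp only [Matrix.mul_apply, Matrix.add_apply, ← Finset.sum_add_distrib]
  exact HasDerivAt.fun_sum fun k _ => (hA i k).mul (hB k j)

lemma eq_neg_mul_mul_of_hasDerivAt_of_mul_eq_one [DecidableEq n] {A P : 𝕜 → Matrix n n K}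
    {A' P' : Matrix n n K} {x : 𝕜} (hA : ∀ i j, HasDerivAt (fun s => A s i j) (A' i j) x)
    (hP : ∀ i j, HasDerivAt (fun s => P s i j) (P' i j) x) (hPA : ∀ᶠ s in 𝓝 x, P s * A s = 1) :
    P' = -(P x * A' * P x) := by
  have hsum : P' * A x + P x * A' = 0 := by
    ext i j
    refine (hasDerivAt_matrix_mul hP hA i j).unique ?_
    exact (hasDerivAt_const x ((1 : Matrix n n K) i j)).congr_of_eventuallyEq <|
      hPA.mono fun s hs => congrFun₂ hs i j
  have hAP : A x * P x = 1 := mul_eq_one_comm.1 hPA.self_of_nhds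
  calc P' = P' * A x * P x := by rw [mul_assoc, hAP, mul_one]
    _ = -(P x * A' * P x) := by rw [eq_neg_of_add_eq_zero_left hsum, neg_mul]

end MatrixCalculus

lemma sum_ite_castSucc_lt_sub {M : Type*} [AddCommGroup M] {k : ℕ} (f : Fin (k + 1) → M)
    (i : Fin (k + 1)) :
    (∑ j : Fin k, if j.castSucc < i then f j.succ - f j.castSucc else 0) = f i - f 0 := by
  induction i using Fin.induction with
  | zero => simp
  | succ i ih =>
    have hsplit (j : Fin k) : (if j.castSucc < i.succ then f j.succ - f j.castSucc else 0) =
        (if j.castSucc < i.castSucc then f j.succ - f j.castSucc else 0) +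
          if j = i then f j.succ - f j.castSucc else 0 := by
      rcases lt_trichotomy j i with h | rfl | h
      · simp [h, h.ne, Fin.castSucc_lt_succ_iff.2 h.le]
      · simp
      · simp [h.ne', h.not_ge, h.not_gt, Fin.castSucc_lt_succ_iff]
    simp only [hsplit, Finset.sum_add_distrib, ih, Finset.sum_ite_eq', Finset.mem_univ, if_true]
    abel

section Markov

variable {K : Type*} [Field K] {k : ℕ}

/-- The coefficients of the one-step prediction error `X (j + 1) - H (j + 1) j * X j` of a Gaussian
vector `X` with correlation matrix `H`. -/
def predictionError (H : Matrix (Fin (k + 1)) (Fin (k + 1)) K) (j : Fin k) : Fin (k + 1) → K :=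
  Pi.single j.succ 1 - H j.succ j.castSucc • Pi.single j.castSucc 1

/-- The variance of the one-step prediction error `X (j + 1) - H (j + 1) j * X j`. -/
def predictionVariance (H : Matrix (Fin (k + 1)) (Fin (k + 1)) K) (j : Fin k) : K :=
  1 - H j.succ j.castSucc * H j.castSucc j.succ

/-- `H` is the correlation matrix of a Markov Gaussian vector: it is multiplicative along monotone
index triples, and consecutive coordinates are not perfectly correlated. -/
structure IsMarkovCorrelation (H : Matrix (Fin (k + 1)) (Fin (k + 1)) K) : Prop where
  diag : ∀ i, H i i = 1
  mul_of_le : ∀ {i j m}, i ≤ j → j ≤ m → H i j * H j m = H i m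
  mul_of_ge : ∀ {i j m}, m ≤ j → j ≤ i → H i j * H j m = H i m
  predictionVariance_ne_zero : ∀ j : Fin k, predictionVariance H j ≠ 0

/-- The inverse of a Markov correlation matrix `H`: the prediction errors are uncorrelated, and
uncorrelated with `X 0`. -/
def markovPrecision (H : Matrix (Fin (k + 1)) (Fin (k + 1)) K) :
    Matrix (Fin (k + 1)) (Fin (k + 1)) K :=
  vecMulVec (Pi.single 0 1) (Pi.single 0 1) +
    ∑ j, (predictionVariance H j)⁻¹ •
      vecMulVec (predictionError Hᵀ j) (predictionError H j)

lemma predictionError_vecMul_apply (H M : Matrix (Fin (k + 1)) (Fin (k + 1)) K) (j : Fin k)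
    (m : Fin (k + 1)) :
    (predictionError H j ᵥ* M) m = M j.succ m - H j.succ j.castSucc * M j.castSucc m := by
  simp [predictionError, sub_vecMul, smul_vecMul]

lemma IsMarkovCorrelation.predictionError_vecMul_self {H : Matrix (Fin (k + 1)) (Fin (k + 1)) K}
    (hH : IsMarkovCorrelation H) (j : Fin k) (m : Fin (k + 1)) :
    (predictionError H j ᵥ* H) m = if j.castSucc < m then
      predictionVariance H j * H j.succ m else 0 := by
  rw [predictionError_vecMul_apply]
  split_ifs with hm
  · rw [← hH.mul_of_le (Fin.castSucc_lt_succ (i := j)).le (Fin.castSucc_lt_iff_succ_le.1 hm)]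
    rw [predictionVariance]
    ring
  · rw [hH.mul_of_ge (not_lt.1 hm) (Fin.castSucc_lt_succ (i := j)).le, sub_self]

lemma IsMarkovCorrelation.markovPrecision_mul_self {H : Matrix (Fin (k + 1)) (Fin (k + 1)) K}
    (hH : IsMarkovCorrelation H) : markovPrecision H * H = 1 := by
  ext i m
  let δ (r : Fin (k + 1)) : K := if i = r then 1 else 0
  have hterm (j : Fin k) : (predictionVariance H j)⁻¹ *
      (predictionError Hᵀ j i * (predictionError H j ᵥ* H) m) =
      if j.castSucc < m then δ j.succ * H j.succ m - δ j.castSucc * H j.castSucc m else 0 := by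
    rw [hH.predictionError_vecMul_self]
    split_ifs with hm
    · rw [← hH.mul_of_le (Fin.castSucc_lt_succ (i := j)).le (Fin.castSucc_lt_iff_succ_le.1 hm)]
      simp only [predictionError, Pi.sub_apply, Pi.smul_apply, Matrix.transpose_apply, smul_eq_mul,
        Pi.single_apply, δ]
      field_simp [hH.predictionVariance_ne_zero j]
    · simp
  calc (markovPrecision H * H) i m = δ 0 * H 0 m +
      ∑ j, (predictionVariance H j)⁻¹ *
        (predictionError Hᵀ j i * (predictionError H j ᵥ* H) m) := by
        simp [markovPrecision, add_mul, Finset.sum_mul, Matrix.sum_apply, vecMulVec_mul,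
          vecMulVec_apply, Pi.single_apply, δ]
    _ = δ m * H m m := by
        simp only [hterm]
        rw [sum_ite_castSucc_lt_sub fun r => δ r * H r m]
        ring
    _ = (1 : Matrix (Fin (k + 1)) (Fin (k + 1)) K) i m := by
        rw [hH.diag, mul_one, Matrix.one_apply]

lemma trace_markovPrecision_mul (H M : Matrix (Fin (k + 1)) (Fin (k + 1)) K) :
    (markovPrecision H * M).trace = M 0 0 +
      ∑ j : Fin k, (predictionVariance H j)⁻¹ *
        (M j.succ j.succ - H j.castSucc j.succ * M j.succ j.castSucc -
          H j.succ j.castSucc * (M j.castSucc j.succ -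
            H j.castSucc j.succ * M j.castSucc j.castSucc)) := by
  simp only [markovPrecision, add_mul, Finset.sum_mul, smul_mul_assoc, Matrix.trace_add,
    Matrix.trace_sum, Matrix.trace_smul, vecMulVec_mul, trace_vecMulVec]
  simp [predictionError, sub_vecMul, smul_vecMul, sub_dotProduct, smul_dotProduct]

end Markov

section MarkovCalculus

variable {𝕜 K : Type*} [NontriviallyNormedField 𝕜] [NontriviallyNormedField K]
  [NormedAlgebra 𝕜 K] {k : ℕ} {H : 𝕜 → Matrix (Fin (k + 1)) (Fin (k + 1)) K}
  {H' B : Matrix (Fin (k + 1)) (Fin (k + 1)) K} {x : 𝕜}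

lemma differentiableAt_markovPrecision (hH : IsMarkovCorrelation (H x))
    (hH' : ∀ i j, DifferentiableAt 𝕜 (fun s => H s i j) x) (i m : Fin (k + 1)) :
    DifferentiableAt 𝕜 (fun s => markovPrecision (H s) i m) x := by
  simp only [markovPrecision, predictionError, predictionVariance, Matrix.add_apply,
    Matrix.sum_apply, Matrix.smul_apply, vecMulVec_apply, Pi.sub_apply, Pi.smul_apply,
    Matrix.transpose_apply, smul_eq_mul]
  fun_prop (disch := exact hH.predictionVariance_ne_zero _)

lemma hasDerivAt_inv_one_sub_mul_mul {z w : 𝕜 → K} {z' w' : K} (hz : HasDerivAt z z' x)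
    (hw : HasDerivAt w w' x) (hzw : 1 - z x * w x ≠ 0) (b c : K) :
    HasDerivAt (fun s => (1 - z s * w s)⁻¹ * (-(w s * b) - z s * c))
      (-((1 - z x * w x)⁻¹ ^ 2 * (z' * w x + z x * w') * (b * w x + z x * c) +
        (1 - z x * w x)⁻¹ * (w' * b + z' * c))) x := by
  have hden : HasDerivAt (fun s => 1 - z s * w s) (-(z' * w x + z x * w')) x :=
    (hz.fun_mul hw).const_sub 1
  have hnum : HasDerivAt (fun s => -(w s * b) - z s * c) (-(w' * b) - z' * c) x :=
    (hw.mul_const b).fun_neg.fun_sub (hz.mul_const c)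
  refine ((hden.fun_inv hzw).fun_mul hnum).congr_deriv ?_
  field_simp
  ring

lemma hasDerivAt_trace_markovPrecision_mul (hH : IsMarkovCorrelation (H x))
    (hH' : ∀ i j, HasDerivAt (fun s => H s i j) (H' i j) x) (hB : ∀ i, B i i = 0) :
    HasDerivAt (fun s => (markovPrecision (H s) * B).trace)
      (-∑ j : Fin k, ((predictionVariance (H x) j)⁻¹ ^ 2 *
        (H' j.succ j.castSucc * H x j.castSucc j.succ +
          H x j.succ j.castSucc * H' j.castSucc j.succ) *
        (B j.succ j.castSucc * H x j.castSucc j.succ +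
          H x j.succ j.castSucc * B j.castSucc j.succ) +
        (predictionVariance (H x) j)⁻¹ *
        (H' j.castSucc j.succ * B j.succ j.castSucc +
          H' j.succ j.castSucc * B j.castSucc j.succ))) x := by
  simp only [trace_markovPrecision_mul, hB, zero_add, mul_zero, sub_zero, zero_sub,
    ← Finset.sum_neg_distrib]
  exact HasDerivAt.fun_sum fun j _ =>
    hasDerivAt_inv_one_sub_mul_mul (hH' _ _) (hH' _ _) (hH.predictionVariance_ne_zero j) _ _

lemma trace_markovPrecision_mul_deriv_mul (hH : ∀ᶠ s in 𝓝 x, IsMarkovCorrelation (H s))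
    (hH' : ∀ i j, HasDerivAt (fun s => H s i j) (H' i j) x) (hB : ∀ i, B i i = 0) :
    (markovPrecision (H x) * H' * markovPrecision (H x) * B).trace =
      ∑ j : Fin k, ((predictionVariance (H x) j)⁻¹ ^ 2 *
        (H' j.succ j.castSucc * H x j.castSucc j.succ +
          H x j.succ j.castSucc * H' j.castSucc j.succ) *
        (B j.succ j.castSucc * H x j.castSucc j.succ +
          H x j.succ j.castSucc * B j.castSucc j.succ) +
        (predictionVariance (H x) j)⁻¹ *
        (H' j.castSucc j.succ * B j.succ j.castSucc +
          H' j.succ j.castSucc * B j.castSucc j.succ)) := by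
  let P' : Matrix (Fin (k + 1)) (Fin (k + 1)) K :=
    Matrix.of fun i m => deriv (fun s => markovPrecision (H s) i m) x
  have hP (i m) : HasDerivAt (fun s => markovPrecision (H s) i m) (P' i m) x :=
    (differentiableAt_markovPrecision hH.self_of_nhds
      (fun i m => (hH' i m).differentiableAt) i m).hasDerivAt
  have hP' : P' = -(markovPrecision (H x) * H' * markovPrecision (H x)) :=
    eq_neg_mul_mul_of_hasDerivAt_of_mul_eq_one (P := fun s => markovPrecision (H s)) hH' hP <|
      hH.mono fun s hs => hs.markovPrecision_mul_self
  have htrace : HasDerivAt (fun s => (markovPrecision (H s) * B).trace) (P' * B).trace x :=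
    HasDerivAt.fun_sum fun i _ => by
      simpa using hasDerivAt_matrix_mul (B' := 0) hP (fun l m => hasDerivAt_const x (B l m)) i i
  rw [← neg_inj, ← htrace.unique (hasDerivAt_trace_markovPrecision_mul hH.self_of_nhds hH' hB),
    hP', neg_mul, trace_neg]

end MarkovCalculus

/-! ### The complex Ornstein-Uhlenbeck covariance -/

/-- The contribution to the damping information of a gap of dimensionless length `x`. -/
noncomputable def dampingGain (x : ℝ) : ℝ :=
  x ^ 2 * (Real.exp (2 * x) + 1) / (Real.exp (2 * x) - 1) ^ 2

/-- The contribution to the frequency information of a gap of dimensionless length `x`. -/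
noncomputable def frequencyGain (x : ℝ) : ℝ := x ^ 2 / (Real.exp (2 * x) - 1)

/-- The logarithm of the complex covariance `E [Y (t + s) * conj (Y t)] / 2`, `s ∈ ℝ`, of the
Ornstein-Uhlenbeck process with damping `l` and frequency `o`. -/
noncomputable def ouExponent (l o s : ℝ) : ℂ := (-l * |s| : ℝ) + (o * s : ℝ) * Complex.I

/-- The complex covariance matrix of the Ornstein-Uhlenbeck process with damping `l` and frequency
`o` at the times `t`. -/
noncomputable def ouCov {n : Type*} (l o : ℝ) (t : n → ℝ) : Matrix n n ℂ :=
  Matrix.of fun i j => Complex.exp (ouExponent l o (t i - t j))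

/-- The derivative of `ouCov l o t` with respect to `(l, o)` in the direction `(a, b)`. -/
noncomputable def ouCovDeriv {n : Type*} (l o a b : ℝ) (t : n → ℝ) : Matrix n n ℂ :=
  Matrix.of fun i j => ouCov l o t i j * ouExponent a b (t i - t j)

lemma ouExponent_of_nonneg (l o : ℝ) {s : ℝ} (hs : 0 ≤ s) :
    ouExponent l o s = -(l * s) + o * s * Complex.I := by
  simp [ouExponent, abs_of_nonneg hs]

lemma ouExponent_neg_of_nonneg (l o : ℝ) {s : ℝ} (hs : 0 ≤ s) :
    ouExponent l o (-s) = -(l * s) - o * s * Complex.I := by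
  simp [ouExponent, abs_of_nonneg hs, sub_eq_add_neg]

lemma ouExponent_add (l o : ℝ) {s r : ℝ} (h : |s + r| = |s| + |r|) :
    ouExponent l o (s + r) = ouExponent l o s + ouExponent l o r := by
  rw [ouExponent, h, ouExponent, ouExponent]
  push_cast
  ring

lemma hasDerivAt_ouCov {n : Type*} {l o : ℝ → ℝ} {a b x : ℝ} (hl : HasDerivAt l a x)
    (ho : HasDerivAt o b x) (t : n → ℝ) (i j : n) :
    HasDerivAt (fun s => ouCov (l s) (o s) t i j) (ouCovDeriv (l x) (o x) a b t i j) x := by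
  have hexp : HasDerivAt (fun s => ouExponent (l s) (o s) (t i - t j))
      (ouExponent a b (t i - t j)) x :=
    (hl.fun_neg.mul_const _).ofReal_comp.fun_add ((ho.mul_const _).ofReal_comp.mul_const _)
  exact hexp.cexp

lemma gap_contribution_eq {l d : ℝ} (hl : l ≠ 0) (hd : Real.exp (2 * (l * d)) ≠ 1)
    (a b a' b' : ℝ) :
    (1 - (Real.exp (2 * (l * d)))⁻¹)⁻¹ ^ 2 *
        (-(Real.exp (2 * (l * d)))⁻¹ * (2 * (a * d))) *
        (-(Real.exp (2 * (l * d)))⁻¹ * (2 * (a' * d))) +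
      (1 - (Real.exp (2 * (l * d)))⁻¹)⁻¹ *
        ((Real.exp (2 * (l * d)))⁻¹ * (2 * d ^ 2 * (a * a' + b * b'))) =
    2 / l ^ 2 * (a * a' * dampingGain (l * d) + b * b' * frequencyGain (l * d)) := by
  rw [dampingGain, frequencyGain]
  have hU := (Real.exp_pos (2 * (l * d))).ne'
  generalize Real.exp (2 * (l * d)) = U at hd hU
  have hU1 : U - 1 ≠ 0 := sub_ne_zero.2 hd
  have hvar : 1 - U⁻¹ = (U - 1) / U := by field_simp
  rw [hvar]
  field_simp
  ring

/-- The distance between the consecutive points `t j` and `t (j + 1)`. -/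
def gap {k : ℕ} (t : Fin (k + 1) → ℝ) (j : Fin k) : ℝ := t j.succ - t j.castSucc

section Gap

variable {k : ℕ} {t : Fin (k + 1) → ℝ}

lemma gap_pos (ht : StrictMono t) (j : Fin k) : 0 < gap t j :=
  sub_pos.2 (ht Fin.castSucc_lt_succ)

lemma ouExponent_gap_add_neg (l o : ℝ) (ht : StrictMono t) (j : Fin k) :
    ouExponent l o (gap t j) + ouExponent l o (-gap t j) =
      ((-(2 * (l * gap t j)) : ℝ) : ℂ) := by
  rw [ouExponent_of_nonneg l o (gap_pos ht j).le, ouExponent_neg_of_nonneg l o (gap_pos ht j).le]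
  push_cast
  ring

lemma ouCov_succ_castSucc (l o : ℝ) (t : Fin (k + 1) → ℝ) (j : Fin k) :
    ouCov l o t j.succ j.castSucc = Complex.exp (ouExponent l o (gap t j)) := rfl

lemma ouCov_castSucc_succ (l o : ℝ) (t : Fin (k + 1) → ℝ) (j : Fin k) :
    ouCov l o t j.castSucc j.succ = Complex.exp (ouExponent l o (-gap t j)) := by
  rw [gap, neg_sub]
  rfl

lemma ouCov_succ_castSucc_mul (l o : ℝ) (ht : StrictMono t) (j : Fin k) :
    ouCov l o t j.succ j.castSucc * ouCov l o t j.castSucc j.succ =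
      ((Real.exp (2 * (l * gap t j)))⁻¹ : ℝ) := by
  rw [ouCov_succ_castSucc, ouCov_castSucc_succ, ← Complex.exp_add, ouExponent_gap_add_neg l o ht,
    ← Complex.ofReal_exp, Real.exp_neg]

lemma exp_two_mul_gap_ne_one {l : ℝ} (hl : l ≠ 0) (ht : StrictMono t) (j : Fin k) :
    Real.exp (2 * (l * gap t j)) ≠ 1 := by
  simp [Real.exp_eq_one_iff, hl, (gap_pos ht j).ne']

lemma isMarkovCorrelation_ouCov {l : ℝ} (hl : l ≠ 0) (o : ℝ) (ht : StrictMono t) :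
    IsMarkovCorrelation (ouCov l o t) where
  diag i := by simp [ouCov, ouExponent]
  predictionVariance_ne_zero j := by
    rw [predictionVariance, ouCov_succ_castSucc_mul l o ht, sub_ne_zero]
    exact_mod_cast (inv_ne_one.2 (exp_two_mul_gap_ne_one hl ht j)).symm
  mul_of_le {i j m} hij hjm := by
    have hi := sub_nonpos.2 (ht.monotone hij)
    have hm := sub_nonpos.2 (ht.monotone hjm)
    have h := ouExponent_add l o ((abs_add_eq_add_abs_iff _ _).2 (.inr ⟨hi, hm⟩))
    rw [sub_add_sub_cancel] at h
    simp [ouCov, h, Complex.exp_add]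
  mul_of_ge {i j m} hmj hji := by
    have hi := sub_nonneg.2 (ht.monotone hji)
    have hm := sub_nonneg.2 (ht.monotone hmj)
    have h := ouExponent_add l o ((abs_add_eq_add_abs_iff _ _).2 (.inl ⟨hi, hm⟩))
    rw [sub_add_sub_cancel] at h
    simp [ouCov, h, Complex.exp_add]

lemma ouCov_inv {l : ℝ} (hl : l ≠ 0) (o : ℝ) (ht : StrictMono t) :
    (ouCov l o t)⁻¹ = markovPrecision (ouCov l o t) :=
  Matrix.inv_eq_left_inv (isMarkovCorrelation_ouCov hl o ht).markovPrecision_mul_self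

lemma ouCovDeriv_succ_castSucc (l o a b : ℝ) (ht : StrictMono t) (j : Fin k) :
    ouCovDeriv l o a b t j.succ j.castSucc =
      ouCov l o t j.succ j.castSucc * (-(a * gap t j) + b * gap t j * Complex.I) := by
  rw [← ouExponent_of_nonneg a b (gap_pos ht j).le]
  rfl

lemma ouCovDeriv_castSucc_succ (l o a b : ℝ) (ht : StrictMono t) (j : Fin k) :
    ouCovDeriv l o a b t j.castSucc j.succ =
      ouCov l o t j.castSucc j.succ * (-(a * gap t j) - b * gap t j * Complex.I) := by
  rw [← ouExponent_neg_of_nonneg a b (gap_pos ht j).le, gap, neg_sub]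
  rfl

lemma ouCovDeriv_mul_add (l o a b : ℝ) (ht : StrictMono t) (j : Fin k) :
    ouCovDeriv l o a b t j.succ j.castSucc * ouCov l o t j.castSucc j.succ +
        ouCov l o t j.succ j.castSucc * ouCovDeriv l o a b t j.castSucc j.succ =
      (-(Real.exp (2 * (l * gap t j)))⁻¹ * (2 * (a * gap t j)) : ℝ) := by
  rw [ouCovDeriv_succ_castSucc l o a b ht, ouCovDeriv_castSucc_succ l o a b ht, neg_mul,
    Complex.ofReal_neg, Complex.ofReal_mul, ← ouCov_succ_castSucc_mul l o ht]
  push_cast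
  ring

lemma ouCovDeriv_mul_add_mul (l o a b a' b' : ℝ) (ht : StrictMono t) (j : Fin k) :
    ouCovDeriv l o a b t j.castSucc j.succ * ouCovDeriv l o a' b' t j.succ j.castSucc +
        ouCovDeriv l o a b t j.succ j.castSucc * ouCovDeriv l o a' b' t j.castSucc j.succ =
      ((Real.exp (2 * (l * gap t j)))⁻¹ * (2 * gap t j ^ 2 * (a * a' + b * b')) : ℝ) := by
  simp only [ouCovDeriv_succ_castSucc l o _ _ ht, ouCovDeriv_castSucc_succ l o _ _ ht]
  rw [Complex.ofReal_mul, ← ouCov_succ_castSucc_mul l o ht]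
  push_cast
  linear_combination -2 * ouCov l o t j.succ j.castSucc * ouCov l o t j.castSucc j.succ *
    (gap t j : ℂ) ^ 2 * b * b' * Complex.I_sq

lemma trace_ouCov_inv_mul_deriv_mul {l : ℝ} (hl : l ≠ 0) (o : ℝ) (ht : StrictMono t)
    (a b a' b' : ℝ) :
    ((ouCov l o t)⁻¹ * ouCovDeriv l o a b t * (ouCov l o t)⁻¹ * ouCovDeriv l o a' b' t).trace =
      (2 / l ^ 2 * ∑ j, (a * a' * dampingGain (l * gap t j) +
        b * b' * frequencyGain (l * gap t j)) : ℝ) := by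
  have hdamping : HasDerivAt (fun s : ℝ => l + a * s) a 0 := by
    simpa using ((hasDerivAt_id (0 : ℝ)).const_mul a).const_add l
  have hfrequency : HasDerivAt (fun s : ℝ => o + b * s) b 0 := by
    simpa using ((hasDerivAt_id (0 : ℝ)).const_mul b).const_add o
  have hmarkov : ∀ᶠ s in 𝓝 (0 : ℝ), IsMarkovCorrelation (ouCov (l + a * s) (o + b * s) t) := by
    have h := hdamping.continuousAt.eventually_ne (y := 0) (by simpa using hl)
    exact h.mono fun s hs => isMarkovCorrelation_ouCov hs _ ht
  have hmain := trace_markovPrecision_mul_deriv_mul hmarkov (hasDerivAt_ouCov hdamping hfrequency t)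
    (B := ouCovDeriv l o a' b' t) (by simp [ouCovDeriv, ouExponent])
  simp only [mul_zero, add_zero] at hmain
  rw [ouCov_inv hl o ht, hmain, Finset.mul_sum, Complex.ofReal_sum]
  refine Finset.sum_congr rfl fun j _ => ?_
  rw [← gap_contribution_eq hl (exp_two_mul_gap_ne_one hl ht j), predictionVariance,
    ouCov_succ_castSucc_mul l o ht, ouCovDeriv_mul_add l o a b ht, ouCovDeriv_mul_add l o a' b' ht,
    ouCovDeriv_mul_add_mul l o a b a' b' ht]
  push_cast
  rfl

end Gap

/-! ### The information matrix of a design -/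

section Realification

variable {n : Type*} [Fintype n] [DecidableEq n]

/-- The real matrix of a complex matrix acting on `(ℝ²)ⁿ`: the entry `z` becomes the block
`!![z.re, -z.im; z.im, z.re]` of the multiplication by `z`. -/
noncomputable def realification : Matrix n n ℂ →+* Matrix (n × Fin 2) (n × Fin 2) ℝ :=
  (compRingEquiv n (Fin 2) ℝ).toRingHom.comp
    (Algebra.leftMulMatrix Complex.basisOneI).toRingHom.mapMatrix

lemma realification_apply (A : Matrix n n ℂ) (p q : n × Fin 2) :
    realification A p q = Algebra.leftMulMatrix Complex.basisOneI (A p.1 q.1) p.2 q.2 := rfl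

lemma trace_realification (A : Matrix n n ℂ) : (realification A).trace = 2 * A.trace.re := by
  simp only [Matrix.trace, Matrix.diag, Fintype.sum_prod_type, realification_apply,
    Algebra.leftMulMatrix_complex, Fin.sum_univ_two, Complex.re_sum, Finset.mul_sum]
  simp [two_mul]

lemma realification_inv {A : Matrix n n ℂ} (hA : IsUnit A) :
    (realification A)⁻¹ = realification A⁻¹ := by
  refine Matrix.inv_eq_left_inv ?_
  rw [← map_mul, Matrix.nonsing_inv_mul A ((Matrix.isUnit_iff_isUnit_det A).1 hA), map_one]

lemma hasDerivAt_realification_apply {A : ℝ → Matrix n n ℂ} {A' : Matrix n n ℂ} {x : ℝ}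
    (hA : ∀ i j, HasDerivAt (fun s => A s i j) (A' i j) x) (p q : n × Fin 2) :
    HasDerivAt (fun s => realification (A s) p q) (realification A' p q) x := by
  let block : ℂ →ₗ[ℝ] ℝ := Matrix.entryLinearMap ℝ ℝ p.2 q.2 ∘ₗ
    (Algebra.leftMulMatrix Complex.basisOneI).toLinearMap
  exact block.toContinuousLinearMap.hasFDerivAt.comp_hasDerivAt x (hA p.1 q.1)

end Realification

lemma leftMulMatrix_basisOneI_conj (z : ℂ) :
    Algebra.leftMulMatrix Complex.basisOneI (star z) =
      (Algebra.leftMulMatrix Complex.basisOneI z)ᵀ := by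
  ext a b
  fin_cases a <;> fin_cases b <;> simp [Algebra.leftMulMatrix_complex]

lemma coord_sub (a : Fin 2) (z w : ℂ) : coord a (z - w) = coord a z - coord a w := by
  fin_cases a <;> simp [coord]

lemma star_exp_ouExponent (l o s : ℝ) :
    star (Complex.exp (ouExponent l o s)) = Complex.exp (ouExponent l o (-s)) := by
  simp [ouExponent, ← Complex.exp_conj]

lemma covFun_sqrt {lam τ : ℝ} (hlam : 0 < lam) (om : ℝ) (hτ : 0 ≤ τ) :
    covFun lam om (Real.sqrt (2 * lam)) τ =
      Algebra.leftMulMatrix Complex.basisOneI (Complex.exp (ouExponent lam om τ)) := by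
  have hvar : Real.sqrt (2 * lam) ^ 2 / (2 * lam) = 1 := by
    rw [Real.sq_sqrt (by positivity), div_self (by positivity)]
  rw [covFun, hvar, one_mul, Algebra.leftMulMatrix_complex, ouExponent, abs_of_nonneg hτ]
  simp [Complex.exp_re, Complex.exp_im, Matrix.smul_of, neg_mul]

section Model

variable {Ω : Type*} [MeasurableSpace Ω] {Z : ℝ≥0 → Ω → ℂ} {P : ℂ → ℝ → ℝ → Measure Ω}

lemma IsStationaryOU.integrable_coord {Y : ℝ≥0 → Ω → ℂ} {μ : Measure Ω} {lam om σ : ℝ}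
    (h : IsStationaryOU Y μ lam om σ) (a : Fin 2) (t : ℝ≥0) :
    Integrable (fun w => coord a (Y t w)) μ := by
  have hi : Integrable (Y t) μ := (h.gaussian.hasGaussianLaw_eval t).integrable
  fin_cases a
  · exact hi.re
  · exact hi.im

lemma IsConstantTrendModel.covariance_coord_of_le (hP : IsConstantTrendModel Z P) (m : ℂ)
    {lam : ℝ} (hlam : 0 < lam) (om : ℝ) {s t : ℝ≥0} (hts : t ≤ s) (a b : Fin 2) :
    covariance (fun w => coord a (Z s w)) (fun w => coord b (Z t w)) (P m lam om) =
      Algebra.leftMulMatrix Complex.basisOneI (Complex.exp (ouExponent lam om (s - t))) a b := by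
  have h := hP m lam om hlam
  have := h.gaussian.isProbabilityMeasure
  have htrend (c : Fin 2) (r : ℝ≥0) :
      (fun w => coord c (Z r w)) = fun w => coord c (Z r w - m) + coord c m := by
    ext w
    rw [coord_sub, sub_add_cancel]
  rw [htrend a s, htrend b t, covariance_add_const_left (h.integrable_coord a s),
    covariance_add_const_right (h.integrable_coord b t),
    ← covFun_sqrt hlam om (sub_nonneg.2 (NNReal.coe_le_coe.2 hts)), ← NNReal.coe_sub hts,
    ← h.covariance t (s - t) a b, add_tsub_cancel_of_le hts]

/-- The times of a design, as real numbers. -/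
abbrev realTimes {ι : Type*} (t : ι → ℝ≥0) : ι → ℝ := fun i => t i

lemma IsAdmissible.strictMono_realTimes {n : ℕ} {t : Fin n → ℝ≥0} (ht : IsAdmissible t) :
    StrictMono (realTimes t) := fun _ _ h => NNReal.coe_lt_coe.2 (ht h)

/-- The dimensionless gap `lam * (t (j + 1) - t j)` of a design. -/
abbrev scaledGap {k : ℕ} (lam : ℝ) (t : Fin (k + 1) → ℝ≥0) (j : Fin k) : ℝ :=
  lam * gap (realTimes t) j

lemma IsAdmissible.scaledGap_pos {k : ℕ} {t : Fin (k + 1) → ℝ≥0} (ht : IsAdmissible t) {lam : ℝ}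
    (hlam : 0 < lam) (j : Fin k) : 0 < scaledGap lam t j :=
  mul_pos hlam (gap_pos ht.strictMono_realTimes j)

lemma IsConstantTrendModel.obsCov_eq (hP : IsConstantTrendModel Z P) (m : ℂ) {lam : ℝ}
    (hlam : 0 < lam) (om : ℝ) {n : ℕ} (t : Fin n → ℝ≥0) :
    obsCov Z (P m lam om) t = realification (ouCov lam om (realTimes t)) := by
  ext p q
  rw [obsCov, Matrix.of_apply, realification_apply, ouCov, Matrix.of_apply]
  rcases le_total (t q.1) (t p.1) with h | h
  · exact hP.covariance_coord_of_le m hlam om h _ _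
  · rw [covariance_comm, hP.covariance_coord_of_le m hlam om h, ← neg_sub (t q.1 : ℝ),
      ← star_exp_ouExponent, leftMulMatrix_basisOneI_conj, transpose_apply]

lemma IsConstantTrendModel.dDamping_eq (hP : IsConstantTrendModel Z P) (m : ℂ) {lam : ℝ}
    (hlam : 0 < lam) (om : ℝ) {n : ℕ} (t : Fin n → ℝ≥0) :
    dDamping Z P m lam om t = realification (ouCovDeriv lam om 1 0 (realTimes t)) := by
  ext p q
  have hderiv := hasDerivAt_realification_apply
    (hasDerivAt_ouCov (hasDerivAt_id lam) (hasDerivAt_const lam om) (realTimes t)) p q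
  refine (hderiv.congr_of_eventuallyEq ?_).deriv
  filter_upwards [lt_mem_nhds hlam] with l hl
  rw [hP.obsCov_eq m hl]
  rfl

lemma IsConstantTrendModel.dFrequency_eq (hP : IsConstantTrendModel Z P) (m : ℂ) {lam : ℝ}
    (hlam : 0 < lam) (om : ℝ) {n : ℕ} (t : Fin n → ℝ≥0) :
    dFrequency Z P m lam om t = realification (ouCovDeriv lam om 0 1 (realTimes t)) := by
  ext p q
  simp only [dFrequency, hP.obsCov_eq m hlam]
  exact (hasDerivAt_realification_apply
    (hasDerivAt_ouCov (hasDerivAt_const om lam) (hasDerivAt_id om) (realTimes t)) p q).deriv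

lemma IsConstantTrendModel.trace_obsCov_inv_mul (hP : IsConstantTrendModel Z P) (m : ℂ) {lam : ℝ}
    (hlam : 0 < lam) (om : ℝ) {k : ℕ} {t : Fin (k + 1) → ℝ≥0} (ht : IsAdmissible t)
    (a b a' b' : ℝ) :
    1 / 2 * ((obsCov Z (P m lam om) t)⁻¹ * realification (ouCovDeriv lam om a b (realTimes t)) *
      (obsCov Z (P m lam om) t)⁻¹ * realification (ouCovDeriv lam om a' b' (realTimes t))).trace =
      2 / lam ^ 2 * ∑ j, (a * a' * dampingGain (scaledGap lam t j) +
        b * b' * frequencyGain (scaledGap lam t j)) := by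
  have hunit : IsUnit (ouCov lam om (realTimes t)) := IsUnit.of_mul_eq_one_right _
    (isMarkovCorrelation_ouCov hlam.ne' om ht.strictMono_realTimes).markovPrecision_mul_self
  rw [hP.obsCov_eq m hlam, realification_inv hunit, ← map_mul, ← map_mul, ← map_mul,
    trace_realification, trace_ouCov_inv_mul_deriv_mul hlam.ne' om ht.strictMono_realTimes,
    Complex.ofReal_re]
  ring

lemma IsConstantTrendModel.infoDamping_eq (hP : IsConstantTrendModel Z P) (m : ℂ) {lam : ℝ}
    (hlam : 0 < lam) (om : ℝ) {k : ℕ} {t : Fin (k + 1) → ℝ≥0} (ht : IsAdmissible t) :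
    infoDamping Z P m lam om t =
      2 / lam ^ 2 * ∑ j, dampingGain (scaledGap lam t j) := by
  rw [infoDamping, hP.dDamping_eq m hlam, hP.trace_obsCov_inv_mul m hlam om ht]
  simp

lemma IsConstantTrendModel.infoFrequency_eq (hP : IsConstantTrendModel Z P) (m : ℂ) {lam : ℝ}
    (hlam : 0 < lam) (om : ℝ) {k : ℕ} {t : Fin (k + 1) → ℝ≥0} (ht : IsAdmissible t) :
    infoFrequency Z P m lam om t =
      2 / lam ^ 2 * ∑ j, frequencyGain (scaledGap lam t j) := by
  rw [infoFrequency, hP.dFrequency_eq m hlam, hP.trace_obsCov_inv_mul m hlam om ht]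
  simp

lemma IsConstantTrendModel.infoMixed_eq_zero (hP : IsConstantTrendModel Z P) (m : ℂ) {lam : ℝ}
    (hlam : 0 < lam) (om : ℝ) {k : ℕ} {t : Fin (k + 1) → ℝ≥0} (ht : IsAdmissible t) :
    infoMixed Z P m lam om t = 0 := by
  rw [infoMixed, hP.dDamping_eq m hlam, hP.dFrequency_eq m hlam,
    hP.trace_obsCov_inv_mul m hlam om ht]
  simp

lemma IsConstantTrendModel.det_infoMatrix_eq (hP : IsConstantTrendModel Z P) (m : ℂ) {lam : ℝ}
    (hlam : 0 < lam) (om : ℝ) {k : ℕ} {t : Fin (k + 1) → ℝ≥0} (ht : IsAdmissible t) :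
    (infoMatrix Z P m lam om t).det = (2 / lam ^ 2) ^ 2 *
      ((∑ j, dampingGain (scaledGap lam t j)) *
        ∑ j, frequencyGain (scaledGap lam t j)) := by
  rw [infoMatrix, Matrix.det_fin_two_of, hP.infoDamping_eq m hlam om ht,
    hP.infoFrequency_eq m hlam om ht, hP.infoMixed_eq_zero m hlam om ht]
  ring

end Model

/-! ### Maximizing the gains of one gap -/

lemma lt_of_hasDerivAt_mul_sub {f w φ : ℝ → ℝ} {a c x : ℝ} (hφ : StrictMonoOn φ (Set.Ioi a))
    (hw : ∀ y, a < y → 0 < w y) (hf : ∀ y, a < y → HasDerivAt f (w y * (φ c - φ y)) y)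
    (hc : a < c) (hx : a < x) (hxc : x ≠ c) : f x < f c := by
  have hcont {y : ℝ} (hy : a < y) (s : Set ℝ) : ContinuousWithinAt f s y :=
    (hf y hy).continuousAt.continuousWithinAt
  rcases lt_or_gt_of_ne hxc with h | h
  · have hmono : StrictMonoOn f (Set.Ioc a c) :=
      strictMonoOn_of_deriv_pos (convex_Ioc a c) (fun y hy => hcont hy.1 _) fun y hy => by
        rw [interior_Ioc] at hy
        rw [(hf y hy.1).deriv]
        exact mul_pos (hw y hy.1) (sub_pos.2 (hφ hy.1 hc hy.2))
    exact hmono ⟨hx, h.le⟩ ⟨hc, le_rfl⟩ h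
  · have hanti : StrictAntiOn f (Set.Ici c) :=
      strictAntiOn_of_deriv_neg (convex_Ici c) (fun y hy => hcont (hc.trans_le hy) _)
        fun y hy => by
          rw [interior_Ici] at hy
          have hay : a < y := hc.trans hy
          rw [(hf y hay).deriv]
          exact mul_neg_of_pos_of_neg (hw y hay) (sub_neg.2 (hφ hc hay hy))
    exact hanti Set.self_mem_Ici h.le h

lemma exp_two_mul_sub_one_pos {x : ℝ} (hx : 0 < x) : 0 < Real.exp (2 * x) - 1 :=
  sub_pos.2 (Real.one_lt_exp_iff.2 (by positivity))

lemma hasDerivAt_exp_two_mul (x : ℝ) :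
    HasDerivAt (fun y : ℝ => Real.exp (2 * y)) (2 * Real.exp (2 * x)) x := by
  simpa [mul_comm] using ((hasDerivAt_id x).const_mul 2).exp

lemma abs_exp_sub_sum_range_le {x : ℝ} (hx : |x| ≤ 1) :
    |Real.exp x - ∑ i ∈ Finset.range 12, x ^ i / i.factorial| ≤ 1 / 10 ^ 8 :=
  calc
    _ ≤ |x| ^ 12 * (((12 : ℕ).succ : ℝ) / ((12 : ℕ).factorial * (12 : ℕ))) :=
      Real.exp_bound hx (by norm_num)
    _ ≤ 1 * (((12 : ℕ).succ : ℝ) / ((12 : ℕ).factorial * (12 : ℕ))) := by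
      gcongr
      exact pow_le_one₀ (abs_nonneg x) hx
    _ ≤ 1 / 10 ^ 8 := by norm_num [Nat.factorial]

lemma dampingGain_pos {x : ℝ} (hx : 0 < x) : 0 < dampingGain x := by
  have := exp_two_mul_sub_one_pos hx
  unfold dampingGain
  positivity

lemma dampingGain_lt_dampingGain_half {x : ℝ} (hx : 0 < x) :
    dampingGain x < dampingGain (x / 2) := by
  have hdouble : Real.exp (2 * x) = Real.exp x ^ 2 := by rw [← Real.exp_nat_mul, Nat.cast_ofNat]
  have hu : 0 < Real.exp x - 1 := sub_pos.2 (Real.one_lt_exp_iff.2 hx)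
  rw [dampingGain, dampingGain, hdouble, mul_div_cancel₀ x two_ne_zero]
  generalize Real.exp x = u at hu
  have hu2 : 0 < u ^ 2 - 1 := by nlinarith
  have hdiff : (x / 2) ^ 2 * (u + 1) / (u - 1) ^ 2 - x ^ 2 * (u ^ 2 + 1) / (u ^ 2 - 1) ^ 2 =
      x ^ 2 * ((u - 1) * (u ^ 2 + 3)) / (4 * (u ^ 2 - 1) ^ 2) := by
    field_simp
    ring
  rw [← sub_pos, hdiff]
  positivity

lemma frequencyGain_pos {x : ℝ} (hx : 0 < x) : 0 < frequencyGain x := by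
  have := exp_two_mul_sub_one_pos hx
  unfold frequencyGain
  positivity

/-- The slope of the secant of `exp (-2 x)` between `0` and `x`; the frequency gain increases as
long as it is below `-1`. -/
noncomputable def expSecantSlope (x : ℝ) : ℝ := (Real.exp (-2 * x) - 1) / x

lemma strictMonoOn_expSecantSlope : StrictMonoOn expSecantSlope (Set.Ioi 0) := by
  intro x (hx : 0 < x) y _ hxy
  have h := strictConvexOn_exp.secant_strict_mono (Set.mem_univ 0) (Set.mem_univ (-2 * y))
    (Set.mem_univ (-2 * x)) (by linarith) (by linarith) (by linarith)
  simp only [Real.exp_zero, sub_zero, div_mul_eq_div_div_swap] at h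
  simpa [expSecantSlope, div_lt_div_right_of_neg] using h

lemma hasDerivAt_frequencyGain {x : ℝ} (hx : 0 < x) :
    HasDerivAt frequencyGain (2 * x ^ 2 * Real.exp (2 * x) / (Real.exp (2 * x) - 1) ^ 2 *
      (-1 - expSecantSlope x)) x := by
  have hu := (exp_two_mul_sub_one_pos hx).ne'
  refine ((hasDerivAt_pow 2 x).fun_div ((hasDerivAt_exp_two_mul x).sub_const 1) hu).congr_deriv ?_
  rw [expSecantSlope, neg_mul, Real.exp_neg]
  field_simp
  ring

lemma frequencyGain_lt_of_expSecantSlope_eq {c x : ℝ} (hc : expSecantSlope c = -1) (hc0 : 0 < c)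
    (hx : 0 < x) (hxc : x ≠ c) : frequencyGain x < frequencyGain c := by
  refine lt_of_hasDerivAt_mul_sub strictMonoOn_expSecantSlope (fun y hy => ?_)
    (fun y hy => hc ▸ hasDerivAt_frequencyGain hy) hc0 hx hxc
  have := exp_two_mul_sub_one_pos hy
  positivity

lemma lambertW_spec {x : ℝ} (hx : -Real.exp (-1) ≤ x) (hx0 : x ≤ 0) :
    -1 ≤ lambertW x ∧ lambertW x * Real.exp (lambertW x) = x := by
  have hcont : ContinuousOn (fun w : ℝ => w * Real.exp w) (Set.Icc (-1) 0) := by fun_prop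
  obtain ⟨w, hw, hwx⟩ := intermediate_value_Icc (by norm_num) hcont
    (show x ∈ Set.Icc _ _ by simpa using ⟨hx, hx0⟩)
  have hex : ∃ w ∈ Set.Ici (-1 : ℝ), w * Real.exp w = x := ⟨w, hw.1, hwx⟩
  exact ⟨Function.invFunOn_mem hex, Function.invFunOn_eq hex⟩

/-- The dimensionless gap that maximizes the frequency gain. -/
noncomputable def frequencyOptimum : ℝ := lambertW (-2 * Real.exp (-2)) / 2 + 1

lemma lambertW_neg_two_mul_exp_spec :
    -1 ≤ lambertW (-2 * Real.exp (-2)) ∧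
      lambertW (-2 * Real.exp (-2)) * Real.exp (lambertW (-2 * Real.exp (-2))) =
        -2 * Real.exp (-2) := by
  refine lambertW_spec ?_ (by simp [Real.exp_nonneg])
  have hexp : Real.exp (-1) = Real.exp (-2) * Real.exp 1 := by rw [← Real.exp_add]; norm_num
  rw [hexp]
  nlinarith [Real.exp_pos (-2), Real.add_one_le_exp (1 : ℝ)]

lemma frequencyOptimum_pos : 0 < frequencyOptimum := by
  rw [frequencyOptimum]
  linarith [lambertW_neg_two_mul_exp_spec.1]

lemma expSecantSlope_frequencyOptimum : expSecantSlope frequencyOptimum = -1 := by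
  rw [expSecantSlope, div_eq_iff frequencyOptimum_pos.ne', frequencyOptimum]
  have hw := lambertW_neg_two_mul_exp_spec.2
  generalize lambertW (-2 * Real.exp (-2)) = w at hw ⊢
  have hsplit : Real.exp (-2 * (w / 2 + 1)) = Real.exp (-2) * Real.exp (-w) := by
    rw [← Real.exp_add]
    ring_nf
  have hinv : Real.exp w * Real.exp (-w) = 1 := by
    rw [← Real.exp_add, add_neg_cancel, Real.exp_zero]
  rw [hsplit]
  linear_combination 1 / 2 * Real.exp (-w) * hw - w / 2 * hinv

lemma frequencyOptimum_approx : |frequencyOptimum - 0.7968| < 0.00005 := by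
  have hsq (y : ℝ) : Real.exp (-2 * y) = Real.exp (-y) ^ 2 := by
    rw [← Real.exp_nat_mul, Nat.cast_ofNat, neg_mul_comm]
  have hbelow : expSecantSlope 0.79675 < -1 := by
    have hexp := abs_le.1 (abs_exp_sub_sum_range_le (x := -0.79675) (by norm_num [abs_le]))
    rw [expSecantSlope, hsq, div_lt_iff₀ (by norm_num)]
    norm_num [Finset.sum_range_succ, Nat.factorial] at hexp ⊢
    nlinarith [hexp.2, Real.exp_pos (-(3187 / 4000))]
  have habove : -1 < expSecantSlope 0.79685 := by
    have hexp := abs_le.1 (abs_exp_sub_sum_range_le (x := -0.79685) (by norm_num [abs_le]))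
    rw [expSecantSlope, hsq, lt_div_iff₀ (by norm_num)]
    norm_num [Finset.sum_range_succ, Nat.factorial] at hexp ⊢
    nlinarith [hexp.1]
  rw [← expSecantSlope_frequencyOptimum] at hbelow habove
  have hlower := (strictMonoOn_expSecantSlope.lt_iff_lt (by norm_num) frequencyOptimum_pos).1 hbelow
  have hupper := (strictMonoOn_expSecantSlope.lt_iff_lt frequencyOptimum_pos (by norm_num)).1 habove
  rw [abs_lt]
  constructor <;> linarith

/-- The Langevin function `coth x - 1 / x`. -/
noncomputable def langevin (x : ℝ) : ℝ := Real.cosh x / Real.sinh x - 1 / x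

lemma langevin_pos {x : ℝ} (hx : 0 < x) : 0 < langevin x := by
  obtain ⟨y, hy, hslope⟩ := exists_hasDerivAt_eq_slope Real.sinh Real.cosh hx
    Real.continuous_sinh.continuousOn fun y _ => Real.hasDerivAt_sinh y
  have hcosh : Real.cosh y < Real.cosh x := Real.cosh_strictMonoOn hy.1.le hx.le hy.2
  rw [hslope, Real.sinh_zero, sub_zero, sub_zero, div_lt_iff₀ hx] at hcosh
  rw [langevin, sub_pos, div_lt_div_iff₀ hx (Real.sinh_pos_iff.2 hx), one_mul]
  exact hcosh

lemma strictMonoOn_langevin : StrictMonoOn langevin (Set.Ioi 0) := by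
  have hderiv {x : ℝ} (hx : 0 < x) : HasDerivAt langevin (1 / x ^ 2 - 1 / Real.sinh x ^ 2) x := by
    have hsinh := (Real.sinh_pos_iff.2 hx).ne'
    refine (((Real.hasDerivAt_cosh x).fun_div (Real.hasDerivAt_sinh x) hsinh).fun_sub
      ((hasDerivAt_const x (1 : ℝ)).fun_div (hasDerivAt_id x) hx.ne')).congr_deriv ?_
    rw [← sq, ← sq, Real.cosh_sq, id]
    ring
  refine strictMonoOn_of_deriv_pos (convex_Ioi 0)
    (fun x hx => (hderiv hx).continuousAt.continuousWithinAt) fun x hx => ?_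
  rw [interior_Ioi] at hx
  have hx : 0 < x := hx
  have hsinh : x < Real.sinh x := Real.self_lt_sinh_iff.2 hx
  rw [(hderiv hx).deriv, sub_pos]
  gcongr

lemma langevin_eq {x : ℝ} (hx : 0 < x) :
    langevin x = (Real.exp (2 * x) + 1) / (Real.exp (2 * x) - 1) - 1 / x := by
  have hu := (exp_two_mul_sub_one_pos hx).ne'
  have hdouble : Real.exp (2 * x) = Real.exp x ^ 2 := by rw [← Real.exp_nat_mul, Nat.cast_ofNat]
  rw [hdouble] at hu ⊢
  rw [langevin, Real.cosh_eq, Real.sinh_eq, Real.exp_neg]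
  have := (Real.exp_pos x).ne'
  field_simp

lemma strictMonoOn_langevin_mul {a b : ℝ} (ha : 1 ≤ a) (hb : 0 < b) :
    StrictMonoOn (fun x => langevin x * (a * Real.exp (b * x) - 1)) (Set.Ioi 0) := by
  intro x (hx : 0 < x) y hy hxy
  have hexp : 1 < Real.exp (b * x) := Real.one_lt_exp_iff.2 (mul_pos hb hx)
  have hfactor : a * Real.exp (b * x) - 1 < a * Real.exp (b * y) - 1 := by gcongr
  exact mul_lt_mul'' (strictMonoOn_langevin hx hy hxy) hfactor (langevin_pos hx).le (by nlinarith)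

/-- The gap criterion to which the product of sums of gains linearizes, up to a factor, at the
equidistant design with dimensionless gap `log U / 2`. -/
noncomputable def supportGain (U x : ℝ) : ℝ :=
  x ^ 2 * (U * Real.exp (2 * x) - 1) / (Real.exp (2 * x) - 1) ^ 2

lemma gain_mul_add_gain_mul {d : ℝ} (hd : 0 < d) (x : ℝ) :
    dampingGain x * frequencyGain d + dampingGain d * frequencyGain x =
      2 * d ^ 2 / (Real.exp (2 * d) - 1) ^ 2 * supportGain (Real.exp (2 * d)) x := by
  have hU := (exp_two_mul_sub_one_pos hd).ne'
  unfold dampingGain frequencyGain supportGain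
  field_simp
  ring

lemma hasDerivAt_supportGain (U : ℝ) {x : ℝ} (hx : 0 < x) :
    HasDerivAt (supportGain U) (2 * x ^ 2 / (Real.exp (2 * x) - 1) ^ 2 *
      (1 - langevin x * (U * Real.exp (2 * x) - 1))) x := by
  have hu := (exp_two_mul_sub_one_pos hx).ne'
  have hexp := hasDerivAt_exp_two_mul x
  refine (((hasDerivAt_pow 2 x).fun_mul ((hexp.const_mul U).sub_const 1)).fun_div
    ((hexp.sub_const 1).fun_pow 2) (pow_ne_zero 2 hu)).congr_deriv ?_
  rw [langevin_eq hx]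
  field_simp
  ring

lemma supportGain_lt_of_langevin_mul_eq {d x : ℝ} (hd : langevin d * (Real.exp (4 * d) - 1) = 1)
    (hd0 : 0 < d) (hx : 0 < x) (hxd : x ≠ d) :
    supportGain (Real.exp (2 * d)) x < supportGain (Real.exp (2 * d)) d := by
  have hdU : langevin d * (Real.exp (2 * d) * Real.exp (2 * d) - 1) = 1 := by
    rwa [← Real.exp_add, ← add_mul, two_add_two_eq_four]
  refine lt_of_hasDerivAt_mul_sub (w := fun y => 2 * y ^ 2 / (Real.exp (2 * y) - 1) ^ 2)
    (strictMonoOn_langevin_mul (Real.one_le_exp (mul_nonneg zero_le_two hd0.le)) two_pos)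
    (fun y hy => ?_) (fun y hy => ?_) hd0 hx hxd
  · have := exp_two_mul_sub_one_pos hy
    positivity
  · simpa only [hdU] using hasDerivAt_supportGain (Real.exp (2 * d)) hy

lemma gain_mul_add_gain_mul_lt {d x : ℝ} (hd : langevin d * (Real.exp (4 * d) - 1) = 1)
    (hd0 : 0 < d) (hx : 0 < x) (hxd : x ≠ d) :
    dampingGain x * frequencyGain d + dampingGain d * frequencyGain x <
      2 * (dampingGain d * frequencyGain d) := by
  have := exp_two_mul_sub_one_pos hd0
  rw [two_mul, gain_mul_add_gain_mul hd0, gain_mul_add_gain_mul hd0]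
  gcongr
  exact supportGain_lt_of_langevin_mul_eq hd hd0 hx hxd

/-- The function whose positive zero is the dimensionless gap that maximizes the determinant of the
information matrix. -/
noncomputable def detStationarity (d : ℝ) : ℝ :=
  1 - d - 2 * d * Real.exp (-2 * d) - Real.exp (-4 * d)

lemma detStationarity_eq_zero_iff {d : ℝ} (hd : 0 < d) :
    detStationarity d = 0 ↔ langevin d * (Real.exp (4 * d) - 1) = 1 := by
  have hu := (exp_two_mul_sub_one_pos hd).ne'
  have hu0 := Real.exp_pos (2 * d)
  have hsq : Real.exp (4 * d) = Real.exp (2 * d) ^ 2 := by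
    rw [← Real.exp_nat_mul, Nat.cast_ofNat]
    ring_nf
  rw [detStationarity, langevin_eq hd, neg_mul, neg_mul, Real.exp_neg, Real.exp_neg, hsq]
  generalize Real.exp (2 * d) = u at hu hu0
  have hfactor : ((u + 1) / (u - 1) - 1 / d) * (u ^ 2 - 1) - 1 =
      -(u ^ 2 / d) * (1 - d - 2 * d * u⁻¹ - (u ^ 2)⁻¹) := by
    field_simp
    ring
  have hne : -(u ^ 2 / d) ≠ 0 := (neg_neg_of_pos (by positivity)).ne
  rw [← sub_eq_zero (b := (1 : ℝ)), hfactor, mul_eq_zero_iff_left hne]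

lemma eq_of_detStationarity_eq_zero {d x : ℝ} (hd : 0 < d) (hx : 0 < x)
    (hdeq : detStationarity d = 0) (hxeq : detStationarity x = 0) : x = d := by
  rw [detStationarity_eq_zero_iff hd] at hdeq
  rw [detStationarity_eq_zero_iff hx] at hxeq
  refine (strictMonoOn_langevin_mul le_rfl (b := 4) (by norm_num)).injOn hx hd ?_
  simp only [one_mul, hxeq, hdeq]

lemma exists_detStationarity_eq_zero :
    ∃ d ∈ Set.Ioo (0.49295 : ℝ) 0.49305, detStationarity d = 0 := by
  have hcont : ContinuousOn detStationarity (Set.Icc 0.49295 0.49305) := by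
    unfold detStationarity
    fun_prop
  have hsq (y : ℝ) : Real.exp (-4 * y) = Real.exp (-2 * y) ^ 2 := by
    rw [← Real.exp_nat_mul, Nat.cast_ofNat]
    ring_nf
  have hleft : 0 < detStationarity 0.49295 := by
    have hexp := abs_le.1 (abs_exp_sub_sum_range_le (x := -2 * 0.49295) (by norm_num [abs_le]))
    rw [detStationarity, hsq]
    norm_num [Finset.sum_range_succ, Nat.factorial] at hexp ⊢
    nlinarith [hexp.2, Real.exp_pos (-(9859 / 10000))]
  have hright : detStationarity 0.49305 < 0 := by
    have hexp := abs_le.1 (abs_exp_sub_sum_range_le (x := -2 * 0.49305) (by norm_num [abs_le]))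
    rw [detStationarity, hsq]
    norm_num [Finset.sum_range_succ, Nat.factorial] at hexp ⊢
    nlinarith [hexp.1]
  exact intermediate_value_Ioo' (by norm_num) hcont ⟨hright, hleft⟩

/-! ### Optimal designs -/

lemma sum_lt_sum_const {ι α M : Type*} [Fintype ι] [AddCommMonoid M] [PartialOrder M]
    [IsOrderedCancelAddMonoid M] {s : Set α} {f : α → M} {c : α}
    (hf : ∀ y ∈ s, y ≠ c → f y < f c) {x : ι → α} (hx : ∀ j, x j ∈ s) (hne : x ≠ fun _ => c) :
    ∑ j, f (x j) < ∑ _j : ι, f c := by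
  obtain ⟨i, hi⟩ := Function.ne_iff.1 hne
  refine Finset.sum_lt_sum (fun j _ => ?_) ⟨i, Finset.mem_univ i, hf _ (hx i) hi⟩
  rcases eq_or_ne (x j) c with h | h
  · rw [h]
  · exact (hf _ (hx j) h).le

lemma sum_mul_sum_lt_const {ι α : Type*} [Fintype ι] {s : Set α} {A B : α → ℝ} {c : α}
    (hA : ∀ y ∈ s, 0 < A y) (hB : ∀ y ∈ s, 0 < B y) (hc : c ∈ s)
    (hAB : ∀ y ∈ s, y ≠ c → A y * B c + A c * B y < 2 * (A c * B c))
    {x : ι → α} (hx : ∀ j, x j ∈ s) (hne : x ≠ fun _ => c) :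
    (∑ j, A (x j)) * ∑ j, B (x j) < (∑ _j : ι, A c) * ∑ _j : ι, B c := by
  have hlinear : (∑ j, A (x j)) * B c + A c * ∑ j, B (x j) <
      2 * (Fintype.card ι * (A c * B c)) := by
    have h := sum_lt_sum_const (f := fun y => A y * B c + A c * B y)
      (fun y hy hyc => (hAB y hy hyc).trans_eq (two_mul _)) hx hne
    simp only [Finset.sum_add_distrib, ← Finset.sum_mul, ← Finset.mul_sum, Finset.sum_const,
      Finset.card_univ, nsmul_eq_mul] at h
    linarith
  have hsumA : 0 ≤ ∑ j, A (x j) := Finset.sum_nonneg fun j _ => (hA _ (hx j)).le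
  have hsumB : 0 ≤ ∑ j, B (x j) := Finset.sum_nonneg fun j _ => (hB _ (hx j)).le
  have hAc := hA c hc
  have hBc := hB c hc
  simp only [Finset.sum_const, Finset.card_univ, nsmul_eq_mul]
  refine lt_of_mul_lt_mul_right ?_ (mul_pos hAc hBc).le
  -- By AM-GM, weighted so that both factors agree at `c`, the linearization bounds the product.
  calc
    _ = (∑ j, A (x j)) * B c * (A c * ∑ j, B (x j)) := by ring
    _ ≤ (((∑ j, A (x j)) * B c + A c * ∑ j, B (x j)) / 2) ^ 2 := by
      linarith [four_mul_le_sq_add ((∑ j, A (x j)) * B c) (A c * ∑ j, B (x j))]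
    _ < (Fintype.card ι * (A c * B c)) ^ 2 := by
      gcongr
      linarith
    _ = _ := by ring

section Gains

variable {ι : Type*} [Fintype ι] {x : ι → ℝ}

lemma sum_dampingGain_lt_half [Nonempty ι] (hx : ∀ j, 0 < x j) :
    ∑ j, dampingGain (x j) < ∑ j, dampingGain (x j / 2) :=
  Finset.sum_lt_sum_of_nonempty Finset.univ_nonempty
    fun j _ => dampingGain_lt_dampingGain_half (hx j)

lemma sum_frequencyGain_lt (hx : ∀ j, 0 < x j) (hne : x ≠ fun _ => frequencyOptimum) :
    ∑ j, frequencyGain (x j) < ∑ _j : ι, frequencyGain frequencyOptimum :=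
  sum_lt_sum_const (s := Set.Ioi 0) (f := frequencyGain) (fun _ hy hyc =>
    frequencyGain_lt_of_expSecantSlope_eq expSecantSlope_frequencyOptimum frequencyOptimum_pos
      hy hyc) hx hne

lemma sum_dampingGain_mul_sum_frequencyGain_lt {d : ℝ} (hd0 : 0 < d)
    (hd : detStationarity d = 0) (hx : ∀ j, 0 < x j) (hne : x ≠ fun _ => d) :
    (∑ j, dampingGain (x j)) * ∑ j, frequencyGain (x j) <
      (∑ _j : ι, dampingGain d) * ∑ _j : ι, frequencyGain d :=
  sum_mul_sum_lt_const (s := Set.Ioi 0) (A := dampingGain) (B := frequencyGain)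
    (fun _ => dampingGain_pos) (fun _ => frequencyGain_pos) hd0
    (fun _ => gain_mul_add_gain_mul_lt ((detStationarity_eq_zero_iff hd0).1 hd) hd0) hx hne

end Gains

lemma isEquidistant_div_iff {k : ℕ} {lam : ℝ} (hlam : lam ≠ 0) (t : Fin (k + 1) → ℝ≥0) (c : ℝ) :
    IsEquidistant t (c / lam) ↔ scaledGap lam t = fun _ => c := by
  have hgap : IsEquidistant t (c / lam) ↔ ∀ j, gap (realTimes t) j = c / lam :=
    ⟨fun h j => h j (Nat.succ_lt_succ j.2), fun h j hj => h ⟨j, Nat.lt_of_succ_lt_succ hj⟩⟩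
  rw [hgap, funext_iff]
  exact forall_congr' fun j => by rw [eq_div_iff hlam, mul_comm]

lemma exists_isAdmissible_isEquidistant (n : ℕ) {d : ℝ} (hd : 0 < d) :
    ∃ t : Fin n → ℝ≥0, IsAdmissible t ∧ IsEquidistant t d := by
  lift d to ℝ≥0 using hd.le
  refine ⟨fun i => (i : ℕ) * d, fun i j hij => ?_, fun j hj => ?_⟩
  · exact mul_lt_mul_of_pos_right (Nat.cast_lt.2 hij) (NNReal.coe_pos.1 hd)
  · push_cast
    ring

section OptimalDesign

variable {k : ℕ} {lam : ℝ} {crit : (Fin (k + 1) → ℝ≥0) → ℝ} {F : (Fin k → ℝ) → ℝ}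

lemma isOptimalDesign_iff_isEquidistant {c : ℝ} (hlam : 0 < lam)
    (hcrit : ∀ s, IsAdmissible s → crit s = F (scaledGap lam s)) (hc : 0 < c)
    (hF : ∀ x, (∀ j, 0 < x j) → x ≠ (fun _ => c) → F x < F fun _ => c)
    {t : Fin (k + 1) → ℝ≥0} (ht : IsAdmissible t) :
    IsOptimalDesign crit t ↔ IsEquidistant t (c / lam) := by
  rw [isEquidistant_div_iff hlam.ne']
  constructor
  · rintro ⟨-, hmax⟩
    by_contra hne
    obtain ⟨s, hs, hsd⟩ := exists_isAdmissible_isEquidistant (k + 1) (div_pos hc hlam)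
    have hle := hmax s hs
    rw [hcrit s hs, hcrit t ht, (isEquidistant_div_iff hlam.ne' s c).1 hsd] at hle
    exact hle.not_gt (hF _ (ht.scaledGap_pos hlam) hne)
  · refine fun heq => ⟨ht, fun s hs => ?_⟩
    rw [hcrit s hs, hcrit t ht, heq]
    rcases eq_or_ne (scaledGap lam s) (fun _ => c) with h | h
    · rw [h]
    · exact (hF _ (hs.scaledGap_pos hlam) h).le

lemma not_isOptimalDesign_of_lt_half (hlam : 0 < lam)
    (hcrit : ∀ s, IsAdmissible s → crit s = F (scaledGap lam s))
    (hF : ∀ x, (∀ j, 0 < x j) → F x < F fun j => x j / 2) (t : Fin (k + 1) → ℝ≥0) :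
    ¬ IsOptimalDesign crit t := by
  rintro ⟨ht, hmax⟩
  have hs : IsAdmissible fun i => t i / 2 := fun i j h => div_lt_div_of_pos_right (ht h) two_pos
  have hhalf : scaledGap lam (fun i => t i / 2) = fun j => scaledGap lam t j / 2 := by
    ext j
    simp only [scaledGap, gap, realTimes, NNReal.coe_div, NNReal.coe_ofNat]
    ring
  have hle := hmax _ hs
  rw [hcrit _ hs, hcrit t ht, hhalf] at hle
  exact hle.not_gt (hF _ (ht.scaledGap_pos hlam))

end OptimalDesign

end ComplexOU

theorem theorem3 {Ω : Type*} [MeasurableSpace Ω] (Z : ℝ≥0 → Ω → ℂ) (P : ℂ → ℝ → ℝ → Measure Ω)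
    (hP : ComplexOU.IsConstantTrendModel Z P) (m : ℂ) (lam om : ℝ) (hlam : 0 < lam) (hom : om ≠ 0)
    (n : ℕ) (hn : 2 ≤ n) :
    (¬ ∃ t : Fin n → ℝ≥0,
      ComplexOU.IsOptimalDesign (ComplexOU.infoDamping Z P m lam om) t) ∧
    ((∀ t : Fin n → ℝ≥0, ComplexOU.IsAdmissible t →
        (ComplexOU.IsOptimalDesign (ComplexOU.infoFrequency Z P m lam om) t ↔
          ComplexOU.IsEquidistant t
            (1 / lam * (ComplexOU.lambertW (-2 * Real.exp (-2)) / 2 + 1)))) ∧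
      |ComplexOU.lambertW (-2 * Real.exp (-2)) / 2 + 1 - 0.7968| < 0.00005) ∧
    (∃ d : ℝ, 0 < d ∧
      1 - d - 2 * d * Real.exp (-2 * d) - Real.exp (-4 * d) = 0 ∧
      (∀ x : ℝ, 0 < x → 1 - x - 2 * x * Real.exp (-2 * x) - Real.exp (-4 * x) = 0 → x = d) ∧
      |d - 0.4930| < 0.00005 ∧
      ∀ t : Fin n → ℝ≥0, ComplexOU.IsAdmissible t →
        (ComplexOU.IsOptimalDesign (fun s => (ComplexOU.infoMatrix Z P m lam om s).det) t ↔
          ComplexOU.IsEquidistant t (d / lam))) := by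
  open ComplexOU in
  obtain ⟨k, rfl⟩ : ∃ k, n = k + 1 := ⟨n - 1, by lia⟩
  have : Nonempty (Fin k) := ⟨⟨0, by lia⟩⟩
  have hscale : 0 < 2 / lam ^ 2 := by positivity
  refine ⟨?_, ⟨fun t ht => ?_, frequencyOptimum_approx⟩, ?_⟩
  · rintro ⟨t, ht⟩
    exact not_isOptimalDesign_of_lt_half hlam (fun s hs => hP.infoDamping_eq m hlam om hs)
      (F := fun x => 2 / lam ^ 2 * ∑ j, dampingGain (x j))
      (fun x hx => mul_lt_mul_of_pos_left (sum_dampingGain_lt_half hx) hscale) t ht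
  · rw [one_div_mul_eq_div]
    exact isOptimalDesign_iff_isEquidistant hlam (fun s hs => hP.infoFrequency_eq m hlam om hs)
      (F := fun x => 2 / lam ^ 2 * ∑ j, frequencyGain (x j)) frequencyOptimum_pos
      (fun x hx hne => mul_lt_mul_of_pos_left (sum_frequencyGain_lt hx hne) hscale) ht
  · obtain ⟨d, ⟨hlower, hupper⟩, hd⟩ := exists_detStationarity_eq_zero
    have hd0 : 0 < d := by linarith
    refine ⟨d, hd0, hd, fun x hx hxeq => eq_of_detStationarity_eq_zero hd0 hx hd hxeq,
      abs_lt.2 ⟨by linarith, by linarith⟩, fun t ht => ?_⟩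
    exact isOptimalDesign_iff_isEquidistant hlam (fun s hs => hP.det_infoMatrix_eq m hlam om hs)
      (F := fun x => (2 / lam ^ 2) ^ 2 * ((∑ j, dampingGain (x j)) * ∑ j, frequencyGain (x j)))
      hd0 (fun x hx hne => mul_lt_mul_of_pos_left
        (sum_dampingGain_mul_sum_frequencyGain_lt hd0 hd hx hne) (pow_pos hscale 2)) ht
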